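/- **Setting.** Let $\varphi:\mathbb R\to\mathbb R$ be an Orlicz $N$-function (continuous, even, convex, $\varphi(0)=0$, strictly increasing on $(0,\infty)$, $\varphi(x)/x\to0$ as $x\to0$ and $\varphi(x)/x\to\infty$ as $x\to\infty$) satisfying the $Q$-condition $\liminf_{x\to0}\varphi(x)/x^2>0$ (the value $+\infty$ is allowed). Let $\varphi^*(x)=\sup_{y}(xy-\varphi(y))$ and let $\varphi^{*(-1)}$ be the inverse of $\varphi^*$ on $[0,\infty)$. A zero-mean random variable $\xi$ is $\varphi$-sub-Gaussian if $\mathsf E e^{\lambda\xi}\le e^{\varphi(\lambda a)}$ for all $\lambda\in\mathbb R$ and some $a\ge0$; $\tau_\varphi(\xi)$ is the infimum of such $a$. Let $(X_t)_{t\in T}$ be a $\varphi$-sub-Gaussian process (every $X_t$ is $\varphi$-sub-Gaussian) which is separable: there is a countable $D\subset T$ such that almost surely, for every $t\in T$, $X_t$ lies in the closure of $\{X_s:s\in D\}$ (automatic if $T$ is countable). Put $d(s,t)=\tau_\varphi(X_t-X_s)$, $\Delta(T)=\sup_{s,t\in T}d(s,t)$, $\|\xi\|_p=(\mathsf E|\xi|^p)^{1/p}$,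 and for $1\le p<\infty$, $k_p=\lfloor\log p/\log2\rfloor$, $$\tilde\gamma_{\varphi,p}(T,d)=\inf_{T_n\subset T,\ \operatorname{card}T_n\le2^{2^n}}\ \sup_{t\in T}\ \sum_{n\ge k_p}\varphi^{*(-1)}(2^n)\,d(t,T_n).$$ All these quantities take values in $[0,\infty]$. **Theorem.** There are universal constants $C_0,C_1,C_6>0$ and constants $C_2,C_3,C_4,C_5>0$ depending only on $\varphi$, which are also universal (take one common value) for all $\varphi$ normalized by $\varphi(x)=x^2/2$ for $|x|<\sqrt2$, such that for all such $\varphi$ and $(X_t)_{t\in T}$ and every $1\le p<\infty$: 1. $$\Big(\mathsf E\sup_{t\in T}|X_t|^p\Big)^{1/p}\le C_0\tilde\gamma_{\varphi,p}(T,d)+\inf_{t_0\in T}\Big\{2\sup_{t\in T}\|X_t-X_{t_0}\|_p+\|X_{t_0}\|_p\Big\}.$$ 2. Consequently, for every $t_0\in T$, $$\Big(\mathsf E\sup_{t\in T}|X_t-X_{t_0}|^p\Big)^{1/p}\le C_1\tilde\gamma_{\varphi,p}(T,d)+C_2\sqrt p\,\Delta(T)+C_3\,p\,\Delta(T)$$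 and $$\Big(\mathsf E\sup_{t\in T}|X_t|^p\Big)^{1/p}\le C_1\tilde\gamma_{\varphi,p}(T,d)+\big(C_2\sqrt p+C_3\,p\big)\big(\Delta(T)+\tau_\varphi(X_{t_0})\big).$$ 3. If $\Delta(T)>0$ and $\tilde\gamma_{\varphi,p}(T,d)<\infty$, then for every $t_0\in T$ and every $u\ge\sqrt2$: if $p\le\max\{1,\varphi^*(u)\}$ (in particular, always if $p=1$), then $$\mathsf P\Big(\sup_{t\in T}|X_t-X_{t_0}|\ge C_4\Delta(T)\varphi^*(u)+C_5\Delta(T)\sqrt{\varphi^*(u)}+C_6\tilde\gamma_{\varphi,p}(T,d)\Big)\le\exp(-\varphi^*(u)),$$ and, without restriction on $p$, the same holds with $\varphi^*(u)$ replaced by $m=\max\{p,\varphi^*(u)\}$ in the threshold: $$\mathsf P\Big(\sup_{t\in T}|X_t-X_{t_0}|\ge C_4\Delta(T)\,m+C_5\Delta(T)\sqrt{m}+C_6\tilde\gamma_{\varphi,p}(T,d)\Big)\le\exp(-\varphi^*(u)).$$ -/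

import Mathlib

open MeasureTheory ProbabilityTheory Filter Topology
open scoped ENNReal NNReal

noncomputable section

namespace PhiSub

/-- Orlicz N-functions. -/
structure IsOrliczN (φ : ℝ → ℝ) : Prop where
  continuous : Continuous φ
  even : ∀ x, φ (-x) = φ x
  convex : ConvexOn ℝ Set.univ φ
  map_zero : φ 0 = 0
  strictMono : StrictMonoOn φ (Set.Ioi 0)
  tendsto_zero : Tendsto (fun x => φ x / x) (𝓝[≠] 0) (𝓝 0)
  tendsto_atTop : Tendsto (fun x => φ x / x) atTop atTop

/-- The Q-condition: the lower limit of `φ x / x ^ 2` at `0` is positive (possibly infinite). -/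
def QCondition (φ : ℝ → ℝ) : Prop :=
  0 < liminf (fun x : ℝ => ENNReal.ofReal (φ x / x ^ 2)) (𝓝[≠] 0)

/-- The standard normalization near the origin: `φ x = x ^ 2 / 2` for `|x| < √2`. -/
def IsStandardized (φ : ℝ → ℝ) : Prop :=
  ∀ x : ℝ, |x| < Real.sqrt 2 → φ x = x ^ 2 / 2

/-- The Young-Fenchel transform (a genuine supremum for every Orlicz N-function). -/
def conj (φ : ℝ → ℝ) (x : ℝ) : ℝ := ⨆ y : ℝ, (x * y - φ y)

/-- The inverse of the restriction to `[0, ∞)` of the Young-Fenchel transform; for an Orlicz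
N-function that restriction is a bijection of `[0, ∞)`. -/
def conjInv (φ : ℝ → ℝ) (y : ℝ) : ℝ := Function.invFunOn (conj φ) (Set.Ici 0) y

section

variable {Ω : Type*} [MeasurableSpace Ω]

/-- `E exp (l ξ) ≤ exp (φ (l a))` for all real `l`, with finite exponential moments. -/
def ExpBound (φ : ℝ → ℝ) (μ : Measure Ω) (ξ : Ω → ℝ) (a : ℝ≥0) : Prop :=
  ∀ l : ℝ, Integrable (fun ω => Real.exp (l * ξ ω)) μ ∧
    ∫ ω, Real.exp (l * ξ ω) ∂μ ≤ Real.exp (φ (l * a))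

/-- Zero-mean random variables with a `φ`-sub-Gaussian distribution. -/
structure IsSubGaussian (φ : ℝ → ℝ) (μ : Measure Ω) (ξ : Ω → ℝ) : Prop where
  aemeasurable : AEMeasurable ξ μ
  integrable : Integrable ξ μ
  mean_zero : ∫ ω, ξ ω ∂μ = 0
  exists_bound : ∃ a : ℝ≥0, ExpBound φ μ ξ a

/-- The `φ`-sub-Gaussian norm; it is finite on `φ`-sub-Gaussian random variables. -/
def tau (φ : ℝ → ℝ) (μ : Measure Ω) (ξ : Ω → ℝ) : ℝ≥0∞ :=
  ⨅ (a : ℝ≥0) (_ : ExpBound φ μ ξ a), (a : ℝ≥0∞)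

/-- `(E f ^ p) ^ (1 / p)` for a nonnegative (extended) random variable `f`. -/
def lpMoment (μ : Measure Ω) (p : ℝ) (f : Ω → ℝ≥0∞) : ℝ≥0∞ :=
  (∫⁻ ω, f ω ^ p ∂μ) ^ (1 / p)

variable {T : Type*}

/-- Separability in the value sense. It holds whenever `T` is countable, and for every process
that is separable in the sense of Doob; it makes suprema over `T` measurable up to null sets. -/
def IsSeparableProcess (μ : Measure Ω) (X : T → Ω → ℝ) : Prop :=
  ∃ D : Set T, D.Countable ∧ ∀ᵐ ω ∂μ, ∀ t : T, X t ω ∈ closure ((fun s => X s ω) '' D)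

/-- `d(s,t) = τ_φ(X_t - X_s)`. -/
def procDist (φ : ℝ → ℝ) (μ : Measure Ω) (X : T → Ω → ℝ) (s t : T) : ℝ≥0∞ :=
  tau φ μ (fun ω => X t ω - X s ω)

/-- The diameter of the whole index set. -/
def diameter (d : T → T → ℝ≥0∞) : ℝ≥0∞ := ⨆ (s : T) (t : T), d s t

/-- `k_p`, the integer part of `log p / log 2`. -/
def kIndex (p : ℝ) : ℕ := ⌊Real.log p / Real.log 2⌋₊

/-- The modified chaining functional: the infimum, over all sequences of subsets `S n` of `T` with
at most `2 ^ (2 ^ n)` points, of the supremum over `t` of the sum over `n ≥ k_p` of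
`φ*⁻¹(2 ^ n) * d(t, S n)`. -/
def gammaTilde (φ : ℝ → ℝ) (p : ℝ) (d : T → T → ℝ≥0∞) : ℝ≥0∞ :=
  ⨅ (S : ℕ → Finset T) (_ : ∀ n, (S n).card ≤ 2 ^ (2 ^ n)),
    ⨆ t : T, ∑' n : {n : ℕ // kIndex p ≤ n},
      ENNReal.ofReal (conjInv φ (2 ^ (n : ℕ))) * ⨅ s ∈ S n, d t s

end

end PhiSub

end

/-! The moment bound is generic chaining started at level `k = k_p`, with the usual union bound
replaced by one random variable that dominates every link. Exponential Markov, with `l` nearly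
optimal in the supremum defining `φ*(x) = A`, is kept in pointwise form: `|ξ| ≤ 8 x τ(ξ) (1 +
g)^(1/p)` with `∫ g ≤ 2 exp(-4A)`, as long as `p ≤ 2A` (`exists_link_bound`). With `A = 2^n` and `n
≥ k` this covers every level, since `p < 2^(k+1)`. Level `n` has at most `8^(2^n)` links and `8
exp(-4) ≤ 1/2`, so the sum `G` of all the functions `g` has integral at most 2
(`exists_links_bound`). Along nearest points the whole chain is then at most a multiple of the
chaining value times `(1 + G)^(1/p)`, whose moment of order `p` is at most 3. The starting points
form a set of at most `2^(2^k) ≤ 2^p` elements, so passing to their maximum costs a factor 2 in the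
moment of order `p`.

A `φ`-sub-Gaussian variable has moments of order `p` at most `2 exp(φ 1) p τ`, which turns the
remaining moments into multiples of the diameter. The tails follow from Markov's inequality at an
order `q ≥ p` that is at least `φ*(u)`, because the chaining functional decreases in `p`. The terms
with square roots are only slack: the linear terms suffice. -/

namespace PhiSub

/-! ### N-functions, their conjugates and the inverse of the conjugate. -/

namespace IsOrliczN

variable {φ : ℝ → ℝ}

lemma nonneg (h : IsOrliczN φ) (x : ℝ) : 0 ≤ φ x := by
  have := h.convex.2 (Set.mem_univ x) (Set.mem_univ (-x)) (by norm_num : (0 : ℝ) ≤ 1 / 2)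
    (by norm_num : (0 : ℝ) ≤ 1 / 2) (by norm_num)
  simp only [smul_eq_mul, h.even] at this
  have h0 : 1 / 2 * x + 1 / 2 * -x = 0 := by ring
  rw [h0, h.map_zero] at this
  linarith

lemma apply_abs (h : IsOrliczN φ) (x : ℝ) : φ |x| = φ x := by
  rcases abs_choice x with hx | hx <;> rw [hx]
  exact h.even x

lemma mono_abs (h : IsOrliczN φ) {x y : ℝ} (hxy : |x| ≤ |y|) : φ x ≤ φ y := by
  rw [← h.apply_abs x, ← h.apply_abs y]
  rcases (abs_nonneg x).eq_or_lt with hx | hx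
  · rw [← hx, h.map_zero]; exact h.nonneg _
  · exact h.strictMono.monotoneOn hx (hx.trans_le hxy) hxy

/-- Superlinear growth: once `φ y ≥ |x| y` for `y ≥ N`, only `|y| ≤ N` can contribute a positive
value. -/
lemma bddAbove (h : IsOrliczN φ) (x : ℝ) : BddAbove (Set.range fun y : ℝ => x * y - φ y) := by
  obtain ⟨N, hN⟩ := (eventually_atTop.1
    ((h.tendsto_atTop.eventually_ge_atTop |x|).and (eventually_gt_atTop 0)))
  refine ⟨|x| * |N|, ?_⟩
  rintro _ ⟨y, rfl⟩
  have h1 : x * y ≤ |x| * |y| := by rw [← abs_mul]; exact le_abs_self _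
  rcases le_total N |y| with hy | hy
  · obtain ⟨h2, h3⟩ := hN _ hy
    rw [le_div_iff₀ h3, h.apply_abs] at h2
    have : 0 ≤ |x| * |N| := by positivity
    simp only
    linarith
  · have h2 : |x| * |y| ≤ |x| * |N| := by
      exact mul_le_mul_of_nonneg_left (hy.trans (le_abs_self N)) (abs_nonneg x)
    have := h.nonneg y
    simp only
    linarith

lemma le_conj (h : IsOrliczN φ) (x y : ℝ) : x * y - φ y ≤ conj φ x :=
  le_ciSup (h.bddAbove x) y

lemma conj_nonneg (h : IsOrliczN φ) (x : ℝ) : 0 ≤ conj φ x := by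
  simpa [h.map_zero] using h.le_conj x 0

lemma conj_zero (h : IsOrliczN φ) : conj φ 0 = 0 := by
  refine le_antisymm (ciSup_le fun y => ?_) (h.conj_nonneg 0)
  have := h.nonneg y
  linarith

lemma conj_mono (h : IsOrliczN φ) {x y : ℝ} (hx : 0 ≤ x) (hxy : x ≤ y) :
    conj φ x ≤ conj φ y := by
  refine ciSup_le fun z => ?_
  rcases le_total 0 z with hz | hz
  · refine le_trans ?_ (h.le_conj y z)
    gcongr
  · have := h.nonneg z
    have := h.conj_nonneg y
    nlinarith [mul_nonneg hx (neg_nonneg.2 hz)]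

lemma conj_convexOn (h : IsOrliczN φ) : ConvexOn ℝ Set.univ (conj φ) := by
  refine ⟨convex_univ, fun x _ y _ a b ha hb hab => ciSup_le fun z => ?_⟩
  have h1 := mul_le_mul_of_nonneg_left (h.le_conj x z) ha
  have h2 := mul_le_mul_of_nonneg_left (h.le_conj y z) hb
  simp only [smul_eq_mul]
  have : (a * x + b * y) * z - φ z = a * (x * z - φ z) + b * (y * z - φ z) := by
    linear_combination φ z * hab
  linarith

lemma conj_continuous (h : IsOrliczN φ) : Continuous (conj φ) :=
  continuousOn_univ.1 (h.conj_convexOn.continuousOn isOpen_univ)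

lemma exists_conj_eq (h : IsOrliczN φ) {y : ℝ} (hy : 0 ≤ y) : ∃ x ∈ Set.Ici (0 : ℝ), conj φ x = y := by
  have h0 : 0 ≤ y + φ 1 := add_nonneg hy (h.nonneg 1)
  have h1 : y ≤ conj φ (y + φ 1) := by simpa using h.le_conj (y + φ 1) 1
  obtain ⟨x, hx, hxy⟩ := intermediate_value_Icc h0 h.conj_continuous.continuousOn
    ⟨h.conj_zero.trans_le hy, h1⟩
  exact ⟨x, hx.1, hxy⟩

lemma conjInv_nonneg (h : IsOrliczN φ) {y : ℝ} (hy : 0 ≤ y) : 0 ≤ conjInv φ y :=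
  Function.invFunOn_mem (h.exists_conj_eq hy)

lemma conj_conjInv (h : IsOrliczN φ) {y : ℝ} (hy : 0 ≤ y) : conj φ (conjInv φ y) = y :=
  Function.invFunOn_eq (h.exists_conj_eq hy)

lemma conjInv_pos (h : IsOrliczN φ) {y : ℝ} (hy : 0 < y) : 0 < conjInv φ y := by
  refine (h.conjInv_nonneg hy.le).lt_of_ne fun h0 => ?_
  have := h.conj_conjInv hy.le
  rw [← h0, h.conj_zero] at this
  exact hy.ne this

lemma conjInv_mono (h : IsOrliczN φ) {x y : ℝ} (hx : 0 ≤ x) (hxy : x ≤ y) :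
    conjInv φ x ≤ conjInv φ y := by
  by_contra! hlt
  have := h.conj_mono (h.conjInv_nonneg (hx.trans hxy)) hlt.le
  rw [h.conj_conjInv hx, h.conj_conjInv (hx.trans hxy)] at this
  rw [le_antisymm hxy this] at hlt
  exact lt_irrefl _ hlt

/-- Since `φ y / y → 0` at the origin, the line of slope `x` lies above `φ` at small positive `y`.
-/
lemma conj_pos (h : IsOrliczN φ) {x : ℝ} (hx : 0 < x) : 0 < conj φ x := by
  have h1 : ∀ᶠ y in 𝓝[>] (0 : ℝ), φ y / y < x :=
    (h.tendsto_zero.mono_left (nhdsWithin_mono _ fun y hy => ne_of_gt hy)).eventually_lt_const hx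
  obtain ⟨y, hy, hy0⟩ := (h1.and self_mem_nhdsWithin).exists
  replace hy0 : 0 < y := hy0
  rw [div_lt_iff₀ hy0] at hy
  linarith [h.le_conj x y]

end IsOrliczN

end PhiSub

namespace PhiSub

/-! ### The norm `tau` and exponential estimates for one variable. -/

section Tau

variable {Ω : Type*} [MeasurableSpace Ω] {μ : Measure Ω} {φ : ℝ → ℝ} {ξ η : Ω → ℝ}

lemma ExpBound.mono (h : IsOrliczN φ) {a b : ℝ≥0} (hab : a ≤ b) (ha : ExpBound φ μ ξ a) :
    ExpBound φ μ ξ b := fun l => by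
  refine ⟨(ha l).1, (ha l).2.trans (Real.exp_le_exp.2 (h.mono_abs ?_))⟩
  rw [abs_mul, abs_mul]
  gcongr

lemma ExpBound.tau_le {a : ℝ≥0} (ha : ExpBound φ μ ξ a) : tau φ μ ξ ≤ a :=
  iInf₂_le a ha

lemma expBound_of_tau_lt (h : IsOrliczN φ) {a : ℝ≥0} (ha : tau φ μ ξ < a) :
    ExpBound φ μ ξ a := by
  simp only [tau, iInf_lt_iff] at ha
  obtain ⟨b, hb, hba⟩ := ha
  exact hb.mono h (by exact_mod_cast hba.le)

lemma IsSubGaussian.tau_ne_top (hξ : IsSubGaussian φ μ ξ) : tau φ μ ξ ≠ ∞ := by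
  obtain ⟨a, ha⟩ := hξ.exists_bound
  exact ne_top_of_le_ne_top ENNReal.coe_ne_top ha.tau_le

/-- The infimum defining `tau` is attained. -/
lemma expBound_tau (h : IsOrliczN φ) (hξ : tau φ μ ξ ≠ ∞) :
    ExpBound φ μ ξ (tau φ μ ξ).toNNReal := by
  set a := (tau φ μ ξ).toNNReal with ha
  have hlt : ∀ b : ℝ≥0, a < b → ExpBound φ μ ξ b := fun b hb =>
    expBound_of_tau_lt h (by rw [← ENNReal.coe_toNNReal hξ]; exact_mod_cast hb)
  intro l
  refine ⟨(hlt (a + 1) (by simp) l).1, ?_⟩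
  have hc : Continuous fun b : ℝ≥0 => Real.exp (φ (l * b)) :=
    Real.continuous_exp.comp (h.continuous.comp (continuous_const.mul NNReal.continuous_coe))
  have ht : Tendsto (fun b : ℝ≥0 => Real.exp (φ (l * b))) (𝓝[>] a) (𝓝 (Real.exp (φ (l * a)))) :=
    (hc.tendsto a).mono_left nhdsWithin_le_nhds
  exact ge_of_tendsto ht (eventually_nhdsWithin_of_forall fun b hb => (hlt b hb l).2)

lemma ExpBound.neg (h : IsOrliczN φ) {a : ℝ≥0} (ha : ExpBound φ μ ξ a) :
    ExpBound φ μ (fun ω => -ξ ω) a := fun l => by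
  simpa [h.even] using ha (-l)

/-- Convexity of `exp` with weights `a / (a + b)` and `b / (a + b)`: the rescaled parameters give
both variables the same bound `exp (φ (l (a + b)))`, so no independence is needed. -/
lemma ExpBound.add {a b : ℝ≥0} (ha0 : 0 < a) (hb0 : 0 < b)
    (ha : ExpBound φ μ ξ a) (hb : ExpBound φ μ η b) (hξ : AEMeasurable ξ μ)
    (hη : AEMeasurable η μ) : ExpBound φ μ (fun ω => ξ ω + η ω) (a + b) := fun l => by
  have ha' : (0 : ℝ) < a := ha0
  have hb' : (0 : ℝ) < b := hb0
  set θ : ℝ := a / (a + b) with hθ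
  set κ : ℝ := b / (a + b) with hκ
  have hθ0 : 0 < θ := by positivity
  have hκ0 : 0 < κ := by positivity
  have hsum : θ + κ = 1 := by rw [hθ, hκ]; field_simp
  obtain ⟨i1, e1⟩ := ha (l / θ)
  obtain ⟨i2, e2⟩ := hb (l / κ)
  have hl1 : l / θ * a = l * (a + b) := by rw [hθ]; field_simp
  have hl2 : l / κ * b = l * (a + b) := by rw [hκ]; field_simp
  rw [hl1] at e1
  rw [hl2] at e2
  have hpt : ∀ ω, Real.exp (l * (ξ ω + η ω)) ≤
      θ * Real.exp (l / θ * ξ ω) + κ * Real.exp (l / κ * η ω) := fun ω => by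
    have := convexOn_exp.2 (Set.mem_univ (l / θ * ξ ω)) (Set.mem_univ (l / κ * η ω)) hθ0.le hκ0.le
      hsum
    simp only [smul_eq_mul] at this
    refine le_trans (le_of_eq ?_) this
    congr 1
    field_simp
  have hint := (i1.const_mul θ).add (i2.const_mul κ)
  have hI : Integrable (fun ω => Real.exp (l * (ξ ω + η ω))) μ := by
    refine hint.mono' ?_ (Eventually.of_forall fun ω => ?_)
    · exact (Real.measurable_exp.comp_aemeasurable
        ((hξ.add hη).const_mul l)).aestronglyMeasurable
    · rw [Real.norm_eq_abs, Real.abs_exp]; exact hpt ω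
  refine ⟨hI, (integral_mono hI hint hpt).trans ?_⟩
  have : ∫ ω, (θ * Real.exp (l / θ * ξ ω) + κ * Real.exp (l / κ * η ω)) ∂μ =
      θ * ∫ ω, Real.exp (l / θ * ξ ω) ∂μ + κ * ∫ ω, Real.exp (l / κ * η ω) ∂μ := by
    rw [integral_add (i1.const_mul θ) (i2.const_mul κ), integral_const_mul, integral_const_mul]
  simp only [Pi.add_apply]
  rw [this]
  push_cast
  calc _ ≤ θ * Real.exp (φ (l * (a + b))) + κ * Real.exp (φ (l * (a + b))) := by gcongr
    _ = _ := by rw [← add_mul, hsum, one_mul]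

lemma tau_neg (h : IsOrliczN φ) : tau φ μ (fun ω => -ξ ω) = tau φ μ ξ := by
  have key : ∀ ζ : Ω → ℝ, tau φ μ (fun ω => -ζ ω) ≤ tau φ μ ζ := fun ζ =>
    le_iInf₂ fun a ha => (ha.neg h).tau_le
  refine le_antisymm (key ξ) ?_
  simpa using key fun ω => -ξ ω

lemma tau_add_le (h : IsOrliczN φ) (hξ : AEMeasurable ξ μ) (hη : AEMeasurable η μ) :
    tau φ μ (fun ω => ξ ω + η ω) ≤ tau φ μ ξ + tau φ μ η := by
  refine ENNReal.le_of_forall_pos_le_add fun ε hε hlt => ?_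
  have h1 : tau φ μ ξ ≠ ∞ := ne_top_of_le_ne_top hlt.ne le_self_add
  have h2 : tau φ μ η ≠ ∞ := ne_top_of_le_ne_top hlt.ne le_add_self
  -- The slack is split in two to make both scales strictly positive, as the convexity weights
  -- require.
  have hε2 : 0 < ε / 2 := by positivity
  have b1 := (expBound_tau h h1).mono h (le_self_add (b := ε / 2))
  have b2 := (expBound_tau h h2).mono h (le_self_add (b := ε / 2))
  refine (ExpBound.add (by positivity) (by positivity) b1 b2 hξ hη).tau_le.trans ?_
  have : (((tau φ μ ξ).toNNReal + ε / 2 + ((tau φ μ η).toNNReal + ε / 2) : ℝ≥0) : ℝ≥0∞)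
      = (((tau φ μ ξ).toNNReal + (tau φ μ η).toNNReal + ε : ℝ≥0) : ℝ≥0∞) := by
    congr 1
    rw [add_add_add_comm, add_halves]
  rw [this]
  push_cast
  rw [ENNReal.coe_toNNReal h1, ENNReal.coe_toNNReal h2]

lemma ExpBound.lintegral_exp_abs_le {a : ℝ≥0} (h : IsOrliczN φ) (ha : ExpBound φ μ ξ a)
    (hξ : AEMeasurable ξ μ) (l : ℝ) :
    ∫⁻ ω, ENNReal.ofReal (Real.exp (l * |ξ ω|)) ∂μ ≤
      ENNReal.ofReal (2 * Real.exp (φ (l * a))) := by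
  have key : ∀ m : ℝ, φ (m * a) = φ (l * a) → ∫⁻ ω, ENNReal.ofReal (Real.exp (m * ξ ω)) ∂μ ≤
      ENNReal.ofReal (Real.exp (φ (l * a))) := fun m hm => by
    rw [← ofReal_integral_eq_lintegral_ofReal (ha m).1
      (Eventually.of_forall fun ω => (Real.exp_pos _).le), ← hm]
    exact ENNReal.ofReal_le_ofReal (ha m).2
  calc ∫⁻ ω, ENNReal.ofReal (Real.exp (l * |ξ ω|)) ∂μ
      ≤ ∫⁻ ω, (ENNReal.ofReal (Real.exp (l * ξ ω)) + ENNReal.ofReal (Real.exp (-l * ξ ω))) ∂μ := by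
        refine lintegral_mono fun ω => ?_
        rcases abs_choice (ξ ω) with hx | hx <;> rw [hx]
        · exact le_self_add
        · rw [mul_neg, neg_mul]; exact le_add_self
    _ = _ := lintegral_add_left' (Real.measurable_exp.comp_aemeasurable
        (hξ.const_mul l)).ennreal_ofReal _
    _ ≤ _ := by
        rw [two_mul, ENNReal.ofReal_add (Real.exp_pos _).le (Real.exp_pos _).le]
        exact add_le_add (key l rfl) (key (-l) (by rw [neg_mul, h.even]))

/-- Every moment of order `p` is at most a multiple of `p` times the norm `tau`. -/
lemma ExpBound.lpMoment_le {a : ℝ≥0} (h : IsOrliczN φ) (ha0 : 0 < a) (ha : ExpBound φ μ ξ a)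
    (hξ : AEMeasurable ξ μ) {p : ℝ} (hp : 1 ≤ p) :
    lpMoment μ p (fun ω => ‖ξ ω‖ₑ) ≤ ENNReal.ofReal (2 * Real.exp (φ 1) * p) * a := by
  have ha' : (0 : ℝ) < a := ha0
  have hp0 : 0 < p := by linarith
  set K : ℝ := 2 * Real.exp (φ 1) with hK
  have hK1 : 1 ≤ K := by
    have := Real.one_le_exp (h.nonneg 1)
    linarith
  have hpt : ∀ ω, ‖ξ ω‖ₑ ^ p ≤ ENNReal.ofReal ((p * a) ^ p) *
      ENNReal.ofReal (Real.exp ((a : ℝ)⁻¹ * |ξ ω|)) := fun ω => by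
    rw [← ENNReal.ofReal_mul (by positivity), Real.enorm_eq_ofReal_abs,
      ENNReal.ofReal_rpow_of_nonneg (abs_nonneg _) hp0.le]
    refine ENNReal.ofReal_le_ofReal ?_
    -- Scaling by `p a` makes the exponent independent of `p`: from `y ≤ exp y` with `y = |ξ| / (p
    -- a)`, the power `p` gives `exp (|ξ| / a)`.
    have hx : |ξ ω| = (p * a) * (|ξ ω| / (p * a)) := by field_simp
    have hy : |ξ ω| / (p * a) ≤ Real.exp (|ξ ω| / (p * a)) := by
      linarith [Real.add_one_le_exp (|ξ ω| / (p * a))]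
    calc |ξ ω| ^ p = (p * a) ^ p * (|ξ ω| / (p * a)) ^ p := by
          rw [← Real.mul_rpow (by positivity) (by positivity), ← hx]
      _ ≤ (p * a) ^ p * Real.exp (|ξ ω| / (p * a)) ^ p := by gcongr
      _ = _ := by
          rw [← Real.exp_mul]
          congr 2
          field_simp
  have hI : ∫⁻ ω, ‖ξ ω‖ₑ ^ p ∂μ ≤ ENNReal.ofReal ((K * p * a) ^ p) := by
    calc ∫⁻ ω, ‖ξ ω‖ₑ ^ p ∂μ
        ≤ ∫⁻ ω, ENNReal.ofReal ((p * a) ^ p) *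
            ENNReal.ofReal (Real.exp ((a : ℝ)⁻¹ * |ξ ω|)) ∂μ := lintegral_mono hpt
      _ = ENNReal.ofReal ((p * a) ^ p) *
            ∫⁻ ω, ENNReal.ofReal (Real.exp ((a : ℝ)⁻¹ * |ξ ω|)) ∂μ :=
          lintegral_const_mul' _ _ ENNReal.ofReal_ne_top
      _ ≤ ENNReal.ofReal ((p * a) ^ p) * ENNReal.ofReal K := by
          refine mul_le_mul_right ((ha.lintegral_exp_abs_le h hξ _).trans_eq ?_) _
          rw [inv_mul_cancel₀ ha'.ne']
      _ ≤ ENNReal.ofReal ((K * p * a) ^ p) := by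
          rw [← ENNReal.ofReal_mul (by positivity)]
          refine ENNReal.ofReal_le_ofReal ?_
          rw [mul_assoc K, Real.mul_rpow (x := K) (by positivity) (by positivity), mul_comm]
          exact mul_le_mul_of_nonneg_right (Real.self_le_rpow_of_one_le hK1 hp) (by positivity)
  calc lpMoment μ p (fun ω => ‖ξ ω‖ₑ) ≤ (ENNReal.ofReal ((K * p * a) ^ p)) ^ (1 / p) := by
        exact ENNReal.rpow_le_rpow hI (by positivity)
    _ = ENNReal.ofReal (K * p) * a := by
        rw [ENNReal.ofReal_rpow_of_nonneg (by positivity) (by positivity), one_div,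
          Real.rpow_rpow_inv (by positivity) hp0.ne', ENNReal.ofReal_mul (by positivity),
          ENNReal.ofReal_coe_nnreal]

/-- Letting the scale decrease to `tau` also covers `tau = 0`, where the strictly positive scale of
`ExpBound.lpMoment_le` is not available. -/
lemma lpMoment_le_tau (h : IsOrliczN φ) (hξ : AEMeasurable ξ μ) {p : ℝ} (hp : 1 ≤ p) :
    lpMoment μ p (fun ω => ‖ξ ω‖ₑ) ≤ ENNReal.ofReal (2 * Real.exp (φ 1) * p) * tau φ μ ξ := by
  have hc : ENNReal.ofReal (2 * Real.exp (φ 1) * p) ≠ 0 := by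
    rw [Ne, ENNReal.ofReal_eq_zero, not_le]; positivity
  rcases eq_or_ne (tau φ μ ξ) ∞ with htop | htop
  · rw [htop, ENNReal.mul_top hc]; exact le_top
  have ht : Tendsto (fun b : ℝ≥0 => ENNReal.ofReal (2 * Real.exp (φ 1) * p) * (b : ℝ≥0∞))
      (𝓝[>] (tau φ μ ξ).toNNReal)
      (𝓝 (ENNReal.ofReal (2 * Real.exp (φ 1) * p) * ((tau φ μ ξ).toNNReal : ℝ≥0∞))) :=
    ((ENNReal.continuous_const_mul ENNReal.ofReal_ne_top).comp
      ENNReal.continuous_coe).tendsto _ |>.mono_left nhdsWithin_le_nhds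
  rw [ENNReal.coe_toNNReal htop] at ht
  refine ge_of_tendsto ht (eventually_nhdsWithin_of_forall fun b hb => ?_)
  refine ExpBound.lpMoment_le h (lt_of_le_of_lt zero_le hb)
    ((expBound_tau h htop).mono h (le_of_lt hb)) hξ hp

lemma lintegral_enorm_le_tau (h : IsOrliczN φ) (hξ : AEMeasurable ξ μ) :
    ∫⁻ ω, ‖ξ ω‖ₑ ∂μ ≤ ENNReal.ofReal (2 * Real.exp (φ 1)) * tau φ μ ξ := by
  simpa [lpMoment] using lpMoment_le_tau h hξ le_rfl

/-- A chaining link: at a scale `x` with `conj φ x = A`, the variable exceeds a multiple of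
`x * tau` only on the part controlled by a function of exponentially small integral. -/
lemma exists_link_bound (h : IsOrliczN φ) (hξ : AEMeasurable ξ μ) (hfin : tau φ μ ξ ≠ ∞)
    {p x A : ℝ} (hp : 1 ≤ p) (hx : 0 < x) (hA : 0 < A) (hxA : conj φ x = A) (hpA : p ≤ 2 * A) :
    ∃ g : Ω → ℝ≥0∞, AEMeasurable g μ ∧
      ∫⁻ ω, g ω ∂μ ≤ ENNReal.ofReal (2 * Real.exp (-(4 * A))) ∧
      ∀ᵐ ω ∂μ, ‖ξ ω‖ₑ ≤ ENNReal.ofReal x * tau φ μ ξ * (8 * (1 + g ω) ^ (1 / p)) := by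
  have hp0 : 0 < p := by linarith
  rcases eq_or_ne (tau φ μ ξ) 0 with h0 | h0
  · refine ⟨fun _ => 0, aemeasurable_const, by simp, ?_⟩
    have hI := lintegral_enorm_le_tau h hξ
    rw [h0, mul_zero, nonpos_iff_eq_zero, lintegral_eq_zero_iff' hξ.enorm] at hI
    filter_upwards [hI] with ω hω
    rw [hω]; exact zero_le
  set a : ℝ := (tau φ μ ξ).toReal with ha
  have ha0 : 0 < a := ENNReal.toReal_pos h0 hfin
  have hta : tau φ μ ξ = ENNReal.ofReal a := (ENNReal.ofReal_toReal hfin).symm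
  -- A near-maximizer, losing half of `A`, gives both `x l > A / 2` and `φ l < x l - A / 2`.
  obtain ⟨l, hl⟩ : ∃ l, A / 2 < x * l - φ l :=
    exists_lt_of_lt_ciSup (show A / 2 < conj φ x by rw [hxA]; linarith)
  have hxl : A / 2 < x * l := by linarith [h.nonneg l]
  -- Chosen so that `c + φ l ≤ -4A`.
  set c : ℝ := -(x * l) - 7 / 2 * A with hc
  refine ⟨fun ω => ENNReal.ofReal (Real.exp c) * ENNReal.ofReal (Real.exp (l / a * |ξ ω|)),
    ?_, ?_, Eventually.of_forall fun ω => ?_⟩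
  · exact ((Real.measurable_exp.comp_aemeasurable
      (hξ.abs.const_mul (l / a))).ennreal_ofReal).const_mul _
  · rw [lintegral_const_mul' _ _ ENNReal.ofReal_ne_top]
    calc _ ≤ ENNReal.ofReal (Real.exp c) * ENNReal.ofReal (2 * Real.exp (φ (l / a * a))) := by
          gcongr
          exact (expBound_tau h hfin).lintegral_exp_abs_le h hξ (l / a)
      _ ≤ _ := by
          rw [← ENNReal.ofReal_mul (Real.exp_pos _).le, div_mul_cancel₀ _ ha0.ne']
          refine ENNReal.ofReal_le_ofReal ?_
          rw [mul_left_comm, ← Real.exp_add]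
          gcongr
          rw [hc]; linarith
  · set y : ℝ := |ξ ω| / (x * a) with hy
    have hy0 : 0 ≤ y := by positivity
    have hyl : c + l / a * |ξ ω| = x * l * (y - 1) - 7 / 2 * A := by
      rw [hc, hy]; field_simp
      ring
    set g : ℝ := Real.exp (x * l * (y - 1) - 7 / 2 * A) with hg
    have hg0 : 0 < g := Real.exp_pos _
    -- For `y ≥ 8` the exponents compare as `(y/8 - 1) p ≤ (y/8 - 1) 2A ≤ (A/2)(y - 1) - 7A/2`; the
    -- last inequality is exactly `y ≥ 8`, which is where the constant comes from.
    have key : y / 8 ≤ (1 + g) ^ (1 / p) := by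
      rcases le_total y 8 with h8 | h8
      · calc y / 8 ≤ 1 := by linarith
          _ ≤ _ := Real.one_le_rpow (by linarith) (by positivity)
      · rw [one_div, Real.le_rpow_inv_iff_of_pos (by positivity) (by positivity) hp0]
        have h1 : y / 8 ≤ Real.exp (y / 8 - 1) := by linarith [Real.add_one_le_exp (y / 8 - 1)]
        calc (y / 8) ^ p ≤ Real.exp (y / 8 - 1) ^ p := by gcongr
          _ = Real.exp ((y / 8 - 1) * p) := by rw [← Real.exp_mul]
          _ ≤ g := by
              refine Real.exp_le_exp.2 ?_
              have e1 : (y / 8 - 1) * p ≤ (y / 8 - 1) * (2 * A) := by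
                gcongr; linarith
              have e2 : A / 2 * (y - 1) ≤ x * l * (y - 1) := by
                gcongr; linarith
              nlinarith
          _ ≤ 1 + g := by linarith
    have hreal : |ξ ω| ≤ x * a * (8 * (1 + g) ^ (1 / p)) := by
      have hxy : |ξ ω| = x * a * y := by rw [hy]; field_simp
      rw [hxy]
      gcongr
      linarith
    beta_reduce
    rw [← ENNReal.ofReal_mul (Real.exp_pos _).le, ← Real.exp_add, hyl, ← hg, hta,
      Real.enorm_eq_ofReal_abs]
    refine (ENNReal.ofReal_le_ofReal hreal).trans_eq ?_
    rw [ENNReal.ofReal_mul (by positivity), ENNReal.ofReal_mul hx.le,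
      ENNReal.ofReal_mul (by norm_num), ← ENNReal.ofReal_rpow_of_nonneg (by positivity)
        (by positivity), ENNReal.ofReal_add zero_le_one hg0.le]
    simp

end Tau

end PhiSub

namespace PhiSub

/-! ### Moments of nonnegative variables and the starting level `kIndex`. -/

section Moments

variable {Ω : Type*} [MeasurableSpace Ω] {μ : Measure Ω} {f g : Ω → ℝ≥0∞} {p : ℝ}

lemma lpMoment_mono_ae (hp : 0 ≤ p) (h : ∀ᵐ ω ∂μ, f ω ≤ g ω) :
    lpMoment μ p f ≤ lpMoment μ p g := by
  refine ENNReal.rpow_le_rpow (lintegral_mono_ae ?_) (by positivity)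
  filter_upwards [h] with ω hω using ENNReal.rpow_le_rpow hω hp

lemma lpMoment_add_le (hp : 1 ≤ p) (hf : AEMeasurable f μ) (hg : AEMeasurable g μ) :
    lpMoment μ p (fun ω => f ω + g ω) ≤ lpMoment μ p f + lpMoment μ p g :=
  ENNReal.lintegral_Lp_add_le hf hg hp

lemma lpMoment_const_mul (hp : 0 < p) {c : ℝ≥0∞} (hc : c ≠ ∞) :
    lpMoment μ p (fun ω => c * f ω) = c * lpMoment μ p f := by
  simp only [lpMoment, ENNReal.mul_rpow_of_nonneg _ _ hp.le]
  rw [lintegral_const_mul' _ _ (ENNReal.rpow_ne_top_of_nonneg hp.le hc),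
    ENNReal.mul_rpow_of_nonneg _ _ (by positivity), ← ENNReal.rpow_mul, mul_one_div_cancel hp.ne',
    ENNReal.rpow_one]

lemma lpMoment_rpow_one_div (hp : 0 < p) :
    lpMoment μ p (fun ω => f ω ^ (1 / p)) = (∫⁻ ω, f ω ∂μ) ^ (1 / p) := by
  simp only [lpMoment, ← ENNReal.rpow_mul, one_div_mul_cancel hp.ne', ENNReal.rpow_one]

lemma lpMoment_rpow_self (hp : 0 < p) : lpMoment μ p f ^ p = ∫⁻ ω, f ω ^ p ∂μ := by
  rw [lpMoment, ← ENNReal.rpow_mul, one_div_mul_cancel hp.ne', ENNReal.rpow_one]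

/-- Markov's inequality at `e` times an upper bound for the moment of order `p`. -/
lemma measure_exp_mul_le (hp : 0 < p) (hf : AEMeasurable f μ) {a M : ℝ≥0∞} (ha0 : a ≠ 0)
    (hat : a ≠ ∞) (hM : lpMoment μ p f ≤ M) (haM : ENNReal.ofReal (Real.exp 1) * M ≤ a) :
    μ {ω | a ≤ f ω} ≤ ENNReal.ofReal (Real.exp (-p)) := by
  have h1 : {ω | a ≤ f ω} = {ω | a ^ p ≤ f ω ^ p} := by
    ext ω
    exact (ENNReal.rpow_le_rpow_iff hp).symm
  have ha0' : a ^ p ≠ 0 := by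
    rw [Ne, ENNReal.rpow_eq_zero_iff_of_pos hp]; exact ha0
  have hat' : a ^ p ≠ ∞ := ENNReal.rpow_ne_top_of_nonneg hp.le hat
  have h2 := mul_meas_ge_le_lintegral₀ (hf.pow_const p) (a ^ p)
  rw [← h1, ← lpMoment_rpow_self hp] at h2
  have h3 : lpMoment μ p f ≤ ENNReal.ofReal (Real.exp (-1)) * a := by
    refine hM.trans ?_
    calc M = ENNReal.ofReal (Real.exp (-1)) * (ENNReal.ofReal (Real.exp 1) * M) := by
          rw [← mul_assoc, ← ENNReal.ofReal_mul (Real.exp_pos _).le, ← Real.exp_add]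
          simp
      _ ≤ _ := by gcongr
  have h4 : lpMoment μ p f ^ p ≤ a ^ p * ENNReal.ofReal (Real.exp (-p)) := by
    refine (ENNReal.rpow_le_rpow h3 hp.le).trans_eq ?_
    rw [ENNReal.mul_rpow_of_nonneg _ _ hp.le, mul_comm,
      ENNReal.ofReal_rpow_of_nonneg (Real.exp_pos _).le hp.le, ← Real.exp_mul, neg_one_mul]
  exact (ENNReal.mul_le_mul_iff_right ha0' hat').1 (h2.trans h4)

lemma two_pow_kIndex_le (hp : 1 ≤ p) : (2 : ℝ) ^ kIndex p ≤ p := by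
  have hl : 0 < Real.log 2 := Real.log_pos one_lt_two
  have h1 : (kIndex p : ℝ) ≤ Real.log p / Real.log 2 :=
    Nat.floor_le (div_nonneg (Real.log_nonneg hp) hl.le)
  rw [le_div_iff₀ hl] at h1
  rw [← Real.log_le_log_iff (by positivity) (by linarith), Real.log_pow]
  exact h1

lemma lt_two_pow_kIndex_succ (hp : 1 ≤ p) : p < (2 : ℝ) ^ (kIndex p + 1) := by
  have hl : 0 < Real.log 2 := Real.log_pos one_lt_two
  have h1 : Real.log p / Real.log 2 < kIndex p + 1 := Nat.lt_floor_add_one _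
  rw [div_lt_iff₀ hl] at h1
  rw [← Real.log_lt_log_iff (by linarith) (by positivity), Real.log_pow]
  exact_mod_cast h1

lemma kIndex_mono {q : ℝ} (hp : 1 ≤ p) (hpq : p ≤ q) : kIndex p ≤ kIndex q := by
  have hl : 0 < Real.log 2 := Real.log_pos one_lt_two
  refine Nat.floor_le_floor ?_
  have := Real.log_le_log (by linarith) hpq
  gcongr

/-- The `ℓ^p` sum dominates the maximum over `F`, and costs only `card F ^ (1/p) ≤ 2` because `2^k ≤
p`. -/
lemma lpMoment_finset_sum_le {ι : Type*} (F : Finset ι) (Y : ι → Ω → ℝ≥0∞) {k : ℕ} {A : ℝ≥0∞}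
    (hp : 1 ≤ p) (hF : F.card ≤ 2 ^ (2 ^ k)) (hk : (2 : ℝ) ^ k ≤ p)
    (hY : ∀ i ∈ F, AEMeasurable (Y i) μ) (hA : ∀ i ∈ F, lpMoment μ p (Y i) ≤ A) :
    lpMoment μ p (fun ω => (∑ i ∈ F, Y i ω ^ p) ^ (1 / p)) ≤ 2 * A := by
  have hp0 : 0 < p := by linarith
  rw [lpMoment_rpow_one_div hp0, lintegral_finsetSum' _ fun i hi => (hY i hi).pow_const p]
  have h1 : ∑ i ∈ F, ∫⁻ ω, Y i ω ^ p ∂μ ≤ (2 * A) ^ p := by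
    calc ∑ i ∈ F, ∫⁻ ω, Y i ω ^ p ∂μ ≤ ∑ i ∈ F, A ^ p := by
          refine Finset.sum_le_sum fun i hi => ?_
          rw [← lpMoment_rpow_self hp0]
          exact ENNReal.rpow_le_rpow (hA i hi) hp0.le
      _ = F.card * A ^ p := by rw [Finset.sum_const, nsmul_eq_mul]
      _ ≤ 2 ^ p * A ^ p := by
          gcongr
          calc (F.card : ℝ≥0∞) ≤ ((2 ^ (2 ^ k) : ℕ) : ℝ≥0∞) := by exact_mod_cast hF
            _ = (2 : ℝ≥0∞) ^ ((2 : ℝ) ^ k) := by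
                rw [show ((2 : ℝ) ^ k) = ((2 ^ k : ℕ) : ℝ) by push_cast; rfl,
                  ENNReal.rpow_natCast]
                push_cast; rfl
            _ ≤ 2 ^ p := ENNReal.rpow_le_rpow_of_exponent_le one_le_two hk
      _ = (2 * A) ^ p := (ENNReal.mul_rpow_of_nonneg _ _ hp0.le).symm
  calc _ ≤ ((2 * A) ^ p) ^ (1 / p) := ENNReal.rpow_le_rpow h1 (by positivity)
    _ = 2 * A := by rw [← ENNReal.rpow_mul, mul_one_div_cancel hp0.ne', ENNReal.rpow_one]

end Moments

/-! ### The distance of the process, separability and simultaneous control of the links. -/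

section Increments

variable {Ω : Type*} [MeasurableSpace Ω] {μ : Measure Ω} {φ : ℝ → ℝ} {T : Type*} {X : T → Ω → ℝ}

lemma procDist_comm (h : IsOrliczN φ) (s t : T) : procDist φ μ X s t = procDist φ μ X t s := by
  rw [procDist, ← tau_neg h]
  simp only [neg_sub]
  rfl

lemma procDist_triangle (h : IsOrliczN φ) (hX : ∀ t, IsSubGaussian φ μ (X t)) (s r t : T) :
    procDist φ μ X s t ≤ procDist φ μ X s r + procDist φ μ X r t := by
  have := tau_add_le h ((hX r).aemeasurable.sub (hX s).aemeasurable)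
    ((hX t).aemeasurable.sub (hX r).aemeasurable)
  simp only [Pi.sub_apply] at this
  refine le_trans (le_of_eq ?_) this
  rw [procDist]
  congr 1
  funext ω
  ring

lemma procDist_ne_top (h : IsOrliczN φ) (hX : ∀ t, IsSubGaussian φ μ (X t)) (s t : T) :
    procDist φ μ X s t ≠ ∞ := by
  have := tau_add_le h (hX t).aemeasurable (hX s).aemeasurable.neg
  simp only [Pi.neg_apply, ← sub_eq_add_neg] at this
  refine ne_top_of_le_ne_top (ENNReal.add_ne_top.2 ⟨(hX t).tau_ne_top, ?_⟩) this
  rw [show (-X s) = fun ω => -X s ω from rfl, tau_neg h]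
  exact (hX s).tau_ne_top

/-- Closed balls contain closures of their subsets. The exceptional null set does not depend on `c`,
so a random centre may be substituted later. -/
lemma IsSeparableProcess.exists_iSup_eq (hsep : IsSeparableProcess μ X) :
    ∃ D : Set T, D.Countable ∧ ∀ᵐ ω ∂μ, ∀ c : ℝ,
      ⨆ t, ‖X t ω - c‖ₑ = ⨆ t ∈ D, ‖X t ω - c‖ₑ := by
  obtain ⟨D, hD, hae⟩ := hsep
  refine ⟨D, hD, ?_⟩
  filter_upwards [hae] with ω hω c
  refine le_antisymm (iSup_le fun t => ?_) (iSup₂_le fun t _ => le_iSup (fun t => ‖X t ω - c‖ₑ) t)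
  have hcl : IsClosed {x : ℝ | ‖x - c‖ₑ ≤ ⨆ t ∈ D, ‖X t ω - c‖ₑ} :=
    isClosed_le (by fun_prop) continuous_const
  refine closure_minimal ?_ hcl (hω t)
  rintro _ ⟨s, hs, rfl⟩
  exact le_iSup₂ (f := fun t (_ : t ∈ D) => ‖X t ω - c‖ₑ) s hs

lemma aemeasurable_iSup_enorm_sub (hX : ∀ t, AEMeasurable (X t) μ) (hsep : IsSeparableProcess μ X)
    {Y : Ω → ℝ} (hY : AEMeasurable Y μ) : AEMeasurable (fun ω => ⨆ t, ‖X t ω - Y ω‖ₑ) μ := by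
  obtain ⟨D, hD, hae⟩ := hsep.exists_iSup_eq
  have : AEMeasurable (fun ω => ⨆ t ∈ D, ‖X t ω - Y ω‖ₑ) μ :=
    AEMeasurable.biSup D hD fun t _ => ((hX t).sub hY).enorm
  refine this.congr ?_
  filter_upwards [hae] with ω hω using (hω (Y ω)).symm

/-- All chaining links are controlled at once by a single random variable. -/
lemma exists_links_bound (h : IsOrliczN φ) (hX : ∀ t, IsSubGaussian φ μ (X t)) {p : ℝ}
    (hp : 1 ≤ p) (S : ℕ → Finset T) (hS : ∀ n, (S n).card ≤ 2 ^ (2 ^ n)) {k : ℕ}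
    (hk : p < 2 ^ (k + 1)) :
    ∃ G : Ω → ℝ≥0∞, AEMeasurable G μ ∧ ∫⁻ ω, G ω ∂μ ≤ 2 ∧
      ∀ᵐ ω ∂μ, ∀ j, ∀ s ∈ S (k + j + 1), ∀ r ∈ S (k + j),
        ‖X s ω - X r ω‖ₑ ≤ ENNReal.ofReal (conjInv φ (2 ^ (k + j))) * procDist φ μ X r s *
          (8 * (1 + G ω) ^ (1 / p)) := by
  have hlink : ∀ (j : ℕ) (q : T × T), ∃ g : Ω → ℝ≥0∞, AEMeasurable g μ ∧
      ∫⁻ ω, g ω ∂μ ≤ ENNReal.ofReal (2 * Real.exp (-(4 * 2 ^ (k + j)))) ∧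
      ∀ᵐ ω ∂μ, ‖X q.1 ω - X q.2 ω‖ₑ ≤ ENNReal.ofReal (conjInv φ (2 ^ (k + j))) *
        procDist φ μ X q.2 q.1 * (8 * (1 + g ω) ^ (1 / p)) := fun j q => by
    refine exists_link_bound h ((hX q.1).aemeasurable.sub (hX q.2).aemeasurable)
      (procDist_ne_top h hX q.2 q.1) hp (h.conjInv_pos (by positivity)) (by positivity)
      (h.conj_conjInv (by positivity)) (hk.le.trans ?_)
    -- The condition `p ≤ 2A` at `A = 2^(k+j)` follows from `p < 2^(k+1)`.
    rw [pow_succ', pow_add]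
    have : (1 : ℝ) ≤ 2 ^ j := one_le_pow₀ one_le_two
    have : (0 : ℝ) < 2 ^ k := by positivity
    nlinarith
  choose g hgm hgi hgb using hlink
  set P : ℕ → Finset (T × T) := fun j => S (k + j + 1) ×ˢ S (k + j) with hP
  refine ⟨fun ω => ∑' j, ∑ q ∈ P j, g j q ω, ?_, ?_, ?_⟩
  · exact AEMeasurable.tsum fun j => Finset.aemeasurable_fun_sum _ fun q _ => hgm j q
  · rw [lintegral_tsum fun j => Finset.aemeasurable_fun_sum _ fun q _ => hgm j q]
    -- At most `2^(2^(n+1)) * 2^(2^n) = 8^(2^n)` pairs, `n = k + j`, each costing `2 exp(-4 * 2^n)`.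
    -- As `8 exp(-4) ≤ 1/2`, the level contributes at most `2 * 2^(-2^n) ≤ 2^(-j)`.
    have hj : ∀ j, ∫⁻ ω, ∑ q ∈ P j, g j q ω ∂μ ≤ (2⁻¹ : ℝ≥0∞) ^ j := fun j => by
      rw [lintegral_finsetSum' _ fun q _ => hgm j q]
      have hcard : ((P j).card : ℝ) ≤ 8 ^ (2 ^ (k + j)) := by
        have : (P j).card ≤ 8 ^ (2 ^ (k + j)) := by
          rw [hP, Finset.card_product]
          calc _ ≤ 2 ^ (2 ^ (k + j + 1)) * 2 ^ (2 ^ (k + j)) := Nat.mul_le_mul (hS _) (hS _)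
            _ = 8 ^ (2 ^ (k + j)) := by
              rw [← pow_add, show (8 : ℕ) = 2 ^ 3 by norm_num, ← pow_mul]
              congr 1
              ring
        exact_mod_cast this
      have he : Real.exp (-4) ≤ 1 / 16 := by
        have h1 : (2 : ℝ) ≤ Real.exp 1 := by
          have := Real.add_one_le_exp (1 : ℝ); linarith
        have h2 : (16 : ℝ) ≤ Real.exp 4 := by
          calc (16 : ℝ) = 2 ^ 4 := by norm_num
            _ ≤ Real.exp 1 ^ 4 := by gcongr
            _ = Real.exp 4 := by rw [← Real.exp_nat_mul]; norm_num
        rw [Real.exp_neg, ← one_div]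
        exact one_div_le_one_div_of_le (by norm_num) h2
      calc _ ≤ ∑ _q ∈ P j, ENNReal.ofReal (2 * Real.exp (-(4 * 2 ^ (k + j)))) :=
            Finset.sum_le_sum fun q _ => hgi j q
        _ = ENNReal.ofReal ((P j).card * (2 * Real.exp (-(4 * 2 ^ (k + j))))) := by
            rw [Finset.sum_const, nsmul_eq_mul, ← ENNReal.ofReal_natCast,
              ← ENNReal.ofReal_mul (by positivity)]
        _ ≤ ENNReal.ofReal (2⁻¹ ^ j) := by
            refine ENNReal.ofReal_le_ofReal ?_
            calc ((P j).card : ℝ) * (2 * Real.exp (-(4 * 2 ^ (k + j))))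
                ≤ 8 ^ (2 ^ (k + j)) * (2 * Real.exp (-(4 * 2 ^ (k + j)))) := by gcongr
              _ = 2 * (8 * Real.exp (-4)) ^ (2 ^ (k + j)) := by
                  rw [mul_pow, ← Real.exp_nat_mul]
                  push_cast
                  ring_nf
              _ ≤ 2 * 2⁻¹ ^ (2 ^ (k + j)) := by
                  gcongr
                  linarith
              _ ≤ 2 * 2⁻¹ ^ (j + 1) := by
                  gcongr 2 * ?_
                  refine pow_le_pow_of_le_one (by norm_num) (by norm_num) ?_
                  calc j + 1 ≤ 2 ^ j := Nat.lt_two_pow_self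
                    _ ≤ 2 ^ (k + j) := Nat.pow_le_pow_right (by norm_num) (by omega)
              _ = 2⁻¹ ^ j := by rw [pow_succ']; ring
        _ = _ := by
            rw [ENNReal.ofReal_pow (by norm_num), ENNReal.ofReal_inv_of_pos (by norm_num)]
            norm_num
    refine (ENNReal.tsum_le_tsum hj).trans ?_
    rw [ENNReal.tsum_geometric, ENNReal.one_sub_inv_two, inv_inv]
  · have hall : ∀ᵐ ω ∂μ, ∀ j, ∀ q ∈ P j, ‖X q.1 ω - X q.2 ω‖ₑ ≤
        ENNReal.ofReal (conjInv φ (2 ^ (k + j))) * procDist φ μ X q.2 q.1 *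
          (8 * (1 + g j q ω) ^ (1 / p)) := by
      rw [ae_all_iff]
      intro j
      exact (ae_ball_iff (P j).countable_toSet).2 fun q _ => hgb j q
    filter_upwards [hall] with ω hω j s hs r hr
    have hq : (s, r) ∈ P j := Finset.mem_product.2 ⟨hs, hr⟩
    refine (hω j (s, r) hq).trans ?_
    gcongr
    calc g j (s, r) ω ≤ ∑ q ∈ P j, g j q ω :=
          Finset.single_le_sum (f := fun q => g j q ω) (fun _ _ => zero_le) hq
      _ ≤ _ := ENNReal.le_tsum (f := fun j => ∑ q ∈ P j, g j q ω) j

/-- First moments are bounded by `tau`, so the sum of the `|X (v j) - X t|` has finite expectation;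
it is almost surely finite and its terms tend to 0. -/
lemma ae_tendsto_of_tsum_procDist_ne_top (h : IsOrliczN φ) (hX : ∀ t, AEMeasurable (X t) μ)
    (v : ℕ → T) (t : T) (hv : ∑' j, procDist φ μ X t (v j) ≠ ∞) :
    ∀ᵐ ω ∂μ, Tendsto (fun j => X (v j) ω) atTop (𝓝 (X t ω)) := by
  have hm : ∀ j, AEMeasurable (fun ω => ‖X (v j) ω - X t ω‖ₑ) μ := fun j =>
    ((hX _).sub (hX t)).enorm
  have hI : ∫⁻ ω, ∑' j, ‖X (v j) ω - X t ω‖ₑ ∂μ ≠ ∞ := by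
    rw [lintegral_tsum hm]
    refine ne_top_of_le_ne_top ?_ (ENNReal.tsum_le_tsum fun j =>
      lintegral_enorm_le_tau h ((hX (v j)).sub (hX t)))
    rw [ENNReal.tsum_mul_left]
    exact ENNReal.mul_ne_top ENNReal.ofReal_ne_top hv
  filter_upwards [ae_lt_top' (AEMeasurable.tsum hm) hI] with ω hω
  rw [tendsto_iff_edist_tendsto_0]
  simp only [edist_eq_enorm_sub]
  exact ENNReal.tendsto_atTop_zero_of_tsum_ne_top hω.ne

end Increments

end PhiSub

namespace PhiSub

/-! ### The chaining bound and its consequences for moments and tails. -/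

section Chaining

variable {Ω : Type*} [MeasurableSpace Ω] {μ : Measure Ω} {φ : ℝ → ℝ}
  {T : Type*} {X : T → Ω → ℝ} {p : ℝ}

/-- The value of the chaining functional on one sequence of subsets. -/
noncomputable def chainValue (φ : ℝ → ℝ) (p : ℝ) (d : T → T → ℝ≥0∞) (S : ℕ → Finset T) : ℝ≥0∞ :=
  ⨆ t : T, ∑' n : {n : ℕ // kIndex p ≤ n},
    ENNReal.ofReal (conjInv φ (2 ^ (n : ℕ))) * ⨅ s ∈ S n, d t s

lemma gammaTilde_eq (d : T → T → ℝ≥0∞) : gammaTilde φ p d =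
    ⨅ (S : ℕ → Finset T) (_ : ∀ n, (S n).card ≤ 2 ^ (2 ^ n)), chainValue φ p d S := rfl

lemma tsum_le_chainValue (φ : ℝ → ℝ) (p : ℝ) (d : T → T → ℝ≥0∞) (S : ℕ → Finset T) (t : T) :
    ∑' j : ℕ, ENNReal.ofReal (conjInv φ (2 ^ (kIndex p + j))) * ⨅ s ∈ S (kIndex p + j), d t s ≤
      chainValue φ p d S := by
  have hinj : Function.Injective
      (fun j : ℕ => (⟨kIndex p + j, Nat.le_add_right _ _⟩ : {n : ℕ // kIndex p ≤ n})) :=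
    fun i j hij => by simpa using hij
  refine le_trans ?_ (le_iSup (fun t : T => ∑' n : {n : ℕ // kIndex p ≤ n},
    ENNReal.ofReal (conjInv φ (2 ^ (n : ℕ))) * ⨅ s ∈ S n, d t s) t)
  exact ENNReal.tsum_comp_le_tsum_of_injective hinj (fun n : {n : ℕ // kIndex p ≤ n} =>
    ENNReal.ofReal (conjInv φ (2 ^ (n : ℕ))) * ⨅ s ∈ S n, d t s)

lemma ofReal_conjInv_ne_zero (h : IsOrliczN φ) (n : ℕ) :
    ENNReal.ofReal (conjInv φ (2 ^ n)) ≠ 0 :=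
  (ENNReal.ofReal_pos.2 (h.conjInv_pos (by positivity))).ne'

/-- Nearest points of the approximating sets along a sequence of finite chaining value. -/
lemma exists_nearest (h : IsOrliczN φ) (d : T → T → ℝ≥0∞) {S : ℕ → Finset T}
    (hV : chainValue φ p d S ≠ ∞) (j : ℕ) (t : T) :
    ∃ s ∈ S (kIndex p + j), d t s = ⨅ s ∈ S (kIndex p + j), d t s := by
  -- An infimum over the empty set is `∞`, and its weight is positive, so an empty level would make
  -- the chaining value infinite.
  have hne : (S (kIndex p + j)).Nonempty := by
    rw [Finset.nonempty_iff_ne_empty]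
    intro he
    refine hV (top_le_iff.1 (le_trans ?_ (tsum_le_chainValue φ p d S t)))
    refine le_trans ?_ (ENNReal.le_tsum j)
    rw [he]
    simp [ENNReal.mul_top (ofReal_conjInv_ne_zero h _)]
  obtain ⟨s, hs, hmin⟩ := Finset.exists_min_image _ (d t) hne
  exact ⟨s, hs, le_antisymm (le_iInf₂ hmin) (iInf₂_le s hs)⟩

/-- The chaining bound for the increments along one sequence of subsets. -/
theorem lpMoment_iSup_sub_le_chainValue [IsProbabilityMeasure μ] (h : IsOrliczN φ) (hX : ∀ t, IsSubGaussian φ μ (X t))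
    (hsep : IsSeparableProcess μ X) (hp : 1 ≤ p) (S : ℕ → Finset T)
    (hS : ∀ n, (S n).card ≤ 2 ^ (2 ^ n)) (t₀ : T) :
    lpMoment μ p (fun ω => ⨆ t, ‖X t ω - X t₀ ω‖ₑ) ≤
      48 * chainValue φ p (procDist φ μ X) S +
        2 * ⨆ t, lpMoment μ p (fun ω => ‖X t ω - X t₀ ω‖ₑ) := by
  have hp0 : 0 < p := by linarith
  have hXm : ∀ t, AEMeasurable (X t) μ := fun t => (hX t).aemeasurable
  set d := procDist φ μ X with hd
  set V := chainValue φ p d S with hVdef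
  rcases eq_or_ne V ∞ with hV | hV
  · rw [hV, ENNReal.mul_top (by norm_num), top_add]; exact le_top
  set k := kIndex p with hkdef
  set x : ℕ → ℝ≥0∞ := fun j => ENNReal.ofReal (conjInv φ (2 ^ (k + j))) with hx
  choose π hπ hπmin using exists_nearest (p := p) h d hV
  have hsum : ∀ t, ∑' j, x j * d t (π j t) ≤ V := fun t => by
    simp only [hπmin]
    exact tsum_le_chainValue φ p d S t
  have hxmono : Monotone x := fun i j hij => ENNReal.ofReal_le_ofReal
    (h.conjInv_mono (by positivity) (pow_le_pow_right₀ one_le_two (by omega)))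
  -- Triangle inequality through `t`; the weights increase with the level, so `x j` may be replaced
  -- by `x (j + 1)` in the second half.
  have hsum2 : ∀ t, ∑' j, x j * d (π j t) (π (j + 1) t) ≤ 2 * V := fun t => by
    calc ∑' j, x j * d (π j t) (π (j + 1) t)
        ≤ ∑' j, (x j * d t (π j t) + x (j + 1) * d t (π (j + 1) t)) := by
          refine ENNReal.tsum_le_tsum fun j => ?_
          calc x j * d (π j t) (π (j + 1) t) ≤ x j * (d t (π j t) + d t (π (j + 1) t)) := by
                gcongr
                rw [hd, procDist_comm h t (π j t)]
                exact procDist_triangle h hX _ _ _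
            _ ≤ _ := by
                rw [mul_add]
                gcongr
                exact hxmono (Nat.le_succ j)
      _ = ∑' j, x j * d t (π j t) + ∑' j, x (j + 1) * d t (π (j + 1) t) := ENNReal.tsum_add
      _ ≤ V + V := by
          gcongr
          · exact hsum t
          · exact (ENNReal.tsum_comp_le_tsum_of_injective (add_left_injective 1)
              (fun j => x j * d t (π j t))).trans (hsum t)
      _ = 2 * V := (two_mul V).symm
  -- All weights are at least `x 0 > 0`, so finiteness of the weighted sum passes to the distances;
  -- this makes the chains converge.
  have hdsum : ∀ t, ∑' j, d t (π j t) ≠ ∞ := fun t hinf => by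
    have h1 : x 0 * ∑' j, d t (π j t) ≤ V := by
      rw [← ENNReal.tsum_mul_left]
      refine (ENNReal.tsum_le_tsum fun j => ?_).trans (hsum t)
      gcongr
      exact hxmono (Nat.zero_le j)
    rw [hinf, ENNReal.mul_top (ofReal_conjInv_ne_zero h _), top_le_iff] at h1
    exact hV h1
  obtain ⟨G, hGm, hGi, hGb⟩ := exists_links_bound h hX hp S hS (lt_two_pow_kIndex_succ hp)
  obtain ⟨D, hD, hDae⟩ := hsep.exists_iSup_eq
  -- Convergence is needed only on the countable set `D`, which keeps the exceptional set null.
  have hconv : ∀ᵐ ω ∂μ, ∀ t ∈ D, Tendsto (fun j => X (π j t) ω) atTop (𝓝 (X t ω)) :=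
    (ae_ball_iff hD).2 fun t _ => ae_tendsto_of_tsum_procDist_ne_top h hXm _ t (hdsum t)
  set M : Ω → ℝ≥0∞ := fun ω => (∑ s ∈ S k, ‖X s ω - X t₀ ω‖ₑ ^ p) ^ (1 / p) with hM
  set Z : Ω → ℝ≥0∞ := fun ω => (1 + G ω) ^ (1 / p) with hZ
  have hMm : AEMeasurable M μ := (Finset.aemeasurable_fun_sum _ fun s _ =>
    (((hXm s).sub (hXm t₀)).enorm.pow_const p)).pow_const _
  have hZm : AEMeasurable Z μ := (hGm.const_add 1).pow_const _
  have hbound : ∀ᵐ ω ∂μ, ⨆ t, ‖X t ω - X t₀ ω‖ₑ ≤ M ω + 16 * V * Z ω := by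
    filter_upwards [hGb, hDae, hconv] with ω hlink heq hlim
    rw [heq]
    refine iSup₂_le fun t ht => ?_
    have hchain : edist (X (π 0 t) ω) (X t ω) ≤ ∑' j, x j * d (π j t) (π (j + 1) t) * (8 * Z ω) := by
      refine edist_le_tsum_of_edist_le_of_tendsto₀ (f := fun j => X (π j t) ω) _ (fun j => ?_)
        (hlim t ht)
      rw [edist_comm, edist_eq_enorm_sub]
      exact hlink j _ (hπ (j + 1) t) _ (hπ j t)
    rw [ENNReal.tsum_mul_right] at hchain
    have hstart : ‖X (π 0 t) ω - X t₀ ω‖ₑ ≤ M ω := by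
      have h1 : ‖X (π 0 t) ω - X t₀ ω‖ₑ ^ p ≤ ∑ s ∈ S k, ‖X s ω - X t₀ ω‖ₑ ^ p :=
        Finset.single_le_sum (f := fun s => ‖X s ω - X t₀ ω‖ₑ ^ p) (fun _ _ => zero_le) (hπ 0 t)
      calc ‖X (π 0 t) ω - X t₀ ω‖ₑ = (‖X (π 0 t) ω - X t₀ ω‖ₑ ^ p) ^ (1 / p) := by
            rw [← ENNReal.rpow_mul, mul_one_div_cancel hp0.ne', ENNReal.rpow_one]
        _ ≤ M ω := ENNReal.rpow_le_rpow h1 (by positivity)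
    calc ‖X t ω - X t₀ ω‖ₑ = edist (X t ω) (X t₀ ω) := (edist_eq_enorm_sub _ _).symm
      _ ≤ edist (X t ω) (X (π 0 t) ω) + edist (X (π 0 t) ω) (X t₀ ω) := edist_triangle _ _ _
      _ = ‖X (π 0 t) ω - X t₀ ω‖ₑ + edist (X (π 0 t) ω) (X t ω) := by
          rw [add_comm, edist_comm (X t ω), edist_eq_enorm_sub (X (π 0 t) ω) (X t₀ ω)]
      _ ≤ M ω + 2 * V * (8 * Z ω) := by
          gcongr
          exact hchain.trans (mul_le_mul_left (hsum2 t) _)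
      _ = M ω + 16 * V * Z ω := by ring
  have hMp : lpMoment μ p M ≤ 2 * ⨆ t, lpMoment μ p (fun ω => ‖X t ω - X t₀ ω‖ₑ) :=
    lpMoment_finset_sum_le (S k) (fun s ω => ‖X s ω - X t₀ ω‖ₑ) hp (hS k) (two_pow_kIndex_le hp)
      (fun s _ => ((hXm s).sub (hXm t₀)).enorm)
      (fun s _ => le_iSup (fun t => lpMoment μ p (fun ω => ‖X t ω - X t₀ ω‖ₑ)) s)
  have hZp : lpMoment μ p Z ≤ 3 := by
    rw [hZ, lpMoment_rpow_one_div hp0, lintegral_add_left measurable_const, lintegral_one,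
      measure_univ]
    calc (1 + ∫⁻ ω, G ω ∂μ) ^ (1 / p) ≤ 3 ^ (1 / p) := by
          refine ENNReal.rpow_le_rpow ?_ (by positivity)
          calc 1 + ∫⁻ ω, G ω ∂μ ≤ 1 + 2 := by gcongr
            _ = 3 := by norm_num
      _ ≤ 3 ^ (1 : ℝ) := by
          refine ENNReal.rpow_le_rpow_of_exponent_le (by norm_num) ?_
          rw [div_le_one hp0]; exact hp
      _ = 3 := ENNReal.rpow_one _
  calc _ ≤ lpMoment μ p (fun ω => M ω + 16 * V * Z ω) := lpMoment_mono_ae hp0.le hbound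
    _ ≤ lpMoment μ p M + lpMoment μ p (fun ω => 16 * V * Z ω) :=
        lpMoment_add_le hp hMm (hZm.const_mul _)
    _ = lpMoment μ p M + 16 * V * lpMoment μ p Z := by
        rw [lpMoment_const_mul hp0 (ENNReal.mul_ne_top (by norm_num) hV)]
    -- The constant is `48 = 2 * 8 * 3`: triangle inequality, link bound, moment of `Z`.
    _ ≤ (2 * ⨆ t, lpMoment μ p (fun ω => ‖X t ω - X t₀ ω‖ₑ)) + 16 * V * 3 := by gcongr
    _ = _ := by
        rw [add_comm]
        congr 1
        rw [mul_right_comm]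
        norm_num

theorem lpMoment_iSup_sub_le [IsProbabilityMeasure μ] (h : IsOrliczN φ) (hX : ∀ t, IsSubGaussian φ μ (X t))
    (hsep : IsSeparableProcess μ X) (hp : 1 ≤ p) (t₀ : T) :
    lpMoment μ p (fun ω => ⨆ t, ‖X t ω - X t₀ ω‖ₑ) ≤
      48 * gammaTilde φ p (procDist φ μ X) +
        2 * ⨆ t, lpMoment μ p (fun ω => ‖X t ω - X t₀ ω‖ₑ) := by
  rw [gammaTilde_eq, ENNReal.mul_iInf_of_ne (by norm_num) (by norm_num), ENNReal.iInf_add]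
  refine le_iInf fun S => ?_
  rw [ENNReal.mul_iInf_of_ne (by norm_num) (by norm_num), ENNReal.iInf_add]
  exact le_iInf fun hS => lpMoment_iSup_sub_le_chainValue h hX hsep hp S hS t₀

theorem lpMoment_iSup_le (hX : ∀ t, IsSubGaussian φ μ (X t))
    (hsep : IsSeparableProcess μ X) (hp : 1 ≤ p) (t₀ : T) :
    lpMoment μ p (fun ω => ⨆ t, ‖X t ω‖ₑ) ≤
      lpMoment μ p (fun ω => ⨆ t, ‖X t ω - X t₀ ω‖ₑ) + lpMoment μ p (fun ω => ‖X t₀ ω‖ₑ) := by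
  refine le_trans (lpMoment_mono_ae (by linarith) (Eventually.of_forall fun ω => ?_))
    (lpMoment_add_le hp (aemeasurable_iSup_enorm_sub (fun t => (hX t).aemeasurable) hsep
      (hX t₀).aemeasurable) (hX t₀).aemeasurable.enorm)
  refine iSup_le fun t => ?_
  calc ‖X t ω‖ₑ = ‖(X t ω - X t₀ ω) + X t₀ ω‖ₑ := by rw [sub_add_cancel]
    _ ≤ ‖X t ω - X t₀ ω‖ₑ + ‖X t₀ ω‖ₑ := enorm_add_le _ _
    _ ≤ _ := by
        gcongr
        exact le_iSup (fun t => ‖X t ω - X t₀ ω‖ₑ) t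

lemma lpMoment_sub_le_diameter (h : IsOrliczN φ) (hX : ∀ t, IsSubGaussian φ μ (X t))
    (hp : 1 ≤ p) (s t : T) : lpMoment μ p (fun ω => ‖X t ω - X s ω‖ₑ) ≤
      ENNReal.ofReal (2 * Real.exp (φ 1) * p) * diameter (procDist φ μ X) := by
  refine (lpMoment_le_tau h ((hX t).aemeasurable.sub (hX s).aemeasurable) hp).trans ?_
  exact mul_le_mul_right (le_iSup₂ (f := fun s t => procDist φ μ X s t) s t) _

theorem lpMoment_iSup_sub_le_diameter [IsProbabilityMeasure μ] (h : IsOrliczN φ) (hX : ∀ t, IsSubGaussian φ μ (X t))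
    (hsep : IsSeparableProcess μ X) (hp : 1 ≤ p) (t₀ : T) :
    lpMoment μ p (fun ω => ⨆ t, ‖X t ω - X t₀ ω‖ₑ) ≤
      48 * gammaTilde φ p (procDist φ μ X) +
        ENNReal.ofReal (4 * Real.exp (φ 1) * p) * diameter (procDist φ μ X) := by
  refine (lpMoment_iSup_sub_le h hX hsep hp t₀).trans (add_le_add le_rfl ?_)
  calc _ ≤ 2 * (ENNReal.ofReal (2 * Real.exp (φ 1) * p) * diameter (procDist φ μ X)) := by
        gcongr
        exact iSup_le fun t => lpMoment_sub_le_diameter h hX hp t₀ t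
    _ = _ := by
        rw [← mul_assoc, show (2 : ℝ≥0∞) = ENNReal.ofReal 2 by simp,
          ← ENNReal.ofReal_mul (by norm_num)]
        congr 2
        ring

/-- A larger order starts the sum at a later level, so it only drops nonnegative terms. -/
lemma gammaTilde_anti {q : ℝ} (hp : 1 ≤ p) (hpq : p ≤ q) (d : T → T → ℝ≥0∞) :
    gammaTilde φ q d ≤ gammaTilde φ p d := by
  refine iInf₂_mono fun S _ => iSup_mono fun t => ?_
  refine ENNReal.tsum_comp_le_tsum_of_injective
    (f := fun n : {n : ℕ // kIndex q ≤ n} =>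
      (⟨n, (kIndex_mono hp hpq).trans n.2⟩ : {n : ℕ // kIndex p ≤ n})) (fun m n hmn => ?_)
    (fun n : {n : ℕ // kIndex p ≤ n} =>
      ENNReal.ofReal (conjInv φ (2 ^ (n : ℕ))) * ⨅ s ∈ S n, d t s)
  simpa [Subtype.ext_iff] using hmn

/-- A finite chaining value puts every point within a fixed finite distance of the finite set at
level `k`, whose mutual distances are finite. -/
lemma diameter_ne_top (h : IsOrliczN φ) (hX : ∀ t, IsSubGaussian φ μ (X t))
    (hγ : gammaTilde φ p (procDist φ μ X) ≠ ∞) : diameter (procDist φ μ X) ≠ ∞ := by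
  set d := procDist φ μ X with hd
  obtain ⟨S, hS⟩ : ∃ S, chainValue φ p d S ≠ ∞ := by
    by_contra! hall
    exact hγ (by rw [gammaTilde_eq]; simp [hall])
  set k := kIndex p with hk
  set x := ENNReal.ofReal (conjInv φ (2 ^ (k + 0))) with hx
  have hx0 : x ≠ 0 := ofReal_conjInv_ne_zero h _
  choose π hπ hπmin using fun t => exists_nearest (p := p) h d hS 0 t
  have hnear : ∀ t, d t (π t) ≤ chainValue φ p d S / x := fun t => by
    rw [ENNReal.le_div_iff_mul_le (Or.inl hx0) (Or.inl ENNReal.ofReal_ne_top), mul_comm, hπmin]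
    exact (ENNReal.le_tsum 0).trans (tsum_le_chainValue φ p d S t)
  set F := S (k + 0)
  set A : ℝ≥0∞ := ∑ s ∈ F, ∑ r ∈ F, d s r with hA
  have hAtop : A ≠ ∞ := ENNReal.sum_ne_top.2 fun s _ => ENNReal.sum_ne_top.2 fun r _ =>
    procDist_ne_top h hX s r
  have hB : chainValue φ p d S / x ≠ ∞ := ENNReal.div_ne_top hS hx0
  refine ne_top_of_le_ne_top (ENNReal.add_ne_top.2 ⟨hB, ENNReal.add_ne_top.2 ⟨hAtop, hB⟩⟩)
    (iSup₂_le fun s t => ?_)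
  calc d s t ≤ d s (π s) + (d (π s) (π t) + d (π t) t) :=
        (procDist_triangle h hX s (π s) t).trans
          (add_le_add le_rfl (procDist_triangle h hX _ _ _))
    _ ≤ _ := by
        refine add_le_add (hnear s) (add_le_add ?_ ?_)
        · exact (Finset.single_le_sum (f := fun r => d (π s) r) (fun _ _ => zero_le) (hπ t)).trans
            (Finset.single_le_sum (f := fun s => ∑ r ∈ F, d s r) (fun _ _ => zero_le) (hπ s))
        · rw [hd, procDist_comm h]; exact hnear t

/-- The deviation bound of order `q`: Markov's inequality for the moment of order `q`. -/
theorem measure_iSup_sub_ge_le [IsProbabilityMeasure μ] (h : IsOrliczN φ) (hX : ∀ t, IsSubGaussian φ μ (X t))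
    (hsep : IsSeparableProcess μ X) (hp : 1 ≤ p) (hΔ : diameter (procDist φ μ X) ≠ 0)
    (hγ : gammaTilde φ p (procDist φ μ X) ≠ ∞) (t₀ : T) {q b c : ℝ} (hpq : p ≤ q)
    (hb : Real.exp 1 * (4 * Real.exp (φ 1) * q) ≤ b) :
    μ {ω | ENNReal.ofReal b * diameter (procDist φ μ X) +
          ENNReal.ofReal c * diameter (procDist φ μ X) +
          ENNReal.ofReal (48 * Real.exp 1) * gammaTilde φ p (procDist φ μ X) ≤
        ⨆ t, ‖X t ω - X t₀ ω‖ₑ} ≤ ENNReal.ofReal (Real.exp (-q)) := by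
  have hq : 1 ≤ q := hp.trans hpq
  have hb0 : 0 < b := lt_of_lt_of_le (by positivity) hb
  have hΔt := diameter_ne_top h hX hγ
  refine measure_exp_mul_le (by linarith) (aemeasurable_iSup_enorm_sub
    (fun t => (hX t).aemeasurable) hsep (hX t₀).aemeasurable) ?_ ?_
    (lpMoment_iSup_sub_le_diameter h hX hsep hq t₀) ?_
  · simp [hb0, hΔ]
  · exact ENNReal.add_ne_top.2 ⟨ENNReal.add_ne_top.2 ⟨ENNReal.mul_ne_top ENNReal.ofReal_ne_top hΔt,
      ENNReal.mul_ne_top ENNReal.ofReal_ne_top hΔt⟩, ENNReal.mul_ne_top ENNReal.ofReal_ne_top hγ⟩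
  -- The term with `c` is discarded; it only raises the threshold.
  · rw [mul_add, add_comm, ← mul_assoc, ← mul_assoc, ← ENNReal.ofReal_mul (Real.exp_pos _).le]
    refine add_le_add (le_add_right ?_) ?_
    · gcongr
    · rw [mul_comm 48, ENNReal.ofReal_mul (Real.exp_pos _).le, ENNReal.ofReal_ofNat]
      gcongr
      exact gammaTilde_anti hp hpq _

end Chaining

/-- A positive constant below `conj φ u / max 1 (conj φ u)` for `√2 ≤ u`. -/
noncomputable def conjFloor (φ : ℝ → ℝ) : ℝ :=
  open Classical in
  if IsStandardized φ then 1 / 2 else if 0 < conj φ (Real.sqrt 2) then min 1 (conj φ (Real.sqrt 2))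
    else 1

lemma conjFloor_pos (φ : ℝ → ℝ) : 0 < conjFloor φ := by
  unfold conjFloor
  split_ifs <;> simp [*]

lemma conjFloor_le_one (φ : ℝ → ℝ) : conjFloor φ ≤ 1 := by
  unfold conjFloor
  split_ifs <;> norm_num

/-- Monotonicity reduces to `u = √2`. In the normalized case testing the supremum at `1 < √2` gives
`φ*(√2) ≥ √2 - 1/2 ≥ 1/2`, a floor independent of `φ`. The last default value in `conjFloor` never
occurs for an N-function and only keeps the constant positive for all `φ`. -/
lemma conjFloor_mul_max_le {φ : ℝ → ℝ} (h : IsOrliczN φ) {u : ℝ} (hu : Real.sqrt 2 ≤ u) :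
    conjFloor φ * max 1 (conj φ u) ≤ conj φ u := by
  have hs : (0 : ℝ) < Real.sqrt 2 := by positivity
  have hmono := h.conj_mono hs.le hu
  have h1 := conjFloor_le_one φ
  have h2 : conjFloor φ ≤ conj φ u := by
    refine le_trans ?_ hmono
    unfold conjFloor
    rw [if_pos (h.conj_pos hs)]
    split_ifs with hst
    · have h12 : (1 : ℝ) < Real.sqrt 2 := by
        rw [Real.lt_sqrt] <;> norm_num
      have h3 := h.le_conj (Real.sqrt 2) 1
      rw [hst 1 (by simpa using h12)] at h3
      linarith
    · exact min_le_right _ _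
  have h0 := h.conj_nonneg u
  rcases max_cases 1 (conj φ u) with ⟨he, _⟩ | ⟨he, _⟩ <;> rw [he]
  · simpa using h2
  · nlinarith

lemma IsStandardized.apply_one {φ : ℝ → ℝ} (h : IsStandardized φ) : φ 1 = 1 / 2 := by
  rw [h 1 (by rw [abs_one, Real.lt_sqrt] <;> norm_num)]
  norm_num

end PhiSub

/-! ### Choice of constants and proof of the theorem. -/

theorem theorem4p1 :
    ∃ (C₀ C₁ C₆ : ℝ) (C₂ C₃ C₄ C₅ : (ℝ → ℝ) → ℝ),
      (0 < C₀ ∧ 0 < C₁ ∧ 0 < C₆ ∧ ∀ φ, 0 < C₂ φ ∧ 0 < C₃ φ ∧ 0 < C₄ φ ∧ 0 < C₅ φ) ∧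
      -- on normalized N-functions all the constants are universal
      (∀ φ ψ : ℝ → ℝ, PhiSub.IsStandardized φ → PhiSub.IsStandardized ψ →
        C₂ φ = C₂ ψ ∧ C₃ φ = C₃ ψ ∧ C₄ φ = C₄ ψ ∧ C₅ φ = C₅ ψ) ∧
      ∀ φ : ℝ → ℝ, PhiSub.IsOrliczN φ → PhiSub.QCondition φ →
      ∀ (Ω : Type*) [MeasurableSpace Ω] (μ : Measure Ω) [IsProbabilityMeasure μ]
        (T : Type*) (X : T → Ω → ℝ),
      (∀ t, PhiSub.IsSubGaussian φ μ (X t)) → PhiSub.IsSeparableProcess μ X →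
      ∀ (d : T → T → ℝ≥0∞), d = PhiSub.procDist φ μ X →
      ∀ p : ℝ, 1 ≤ p →
        -- the moment bound
        (PhiSub.lpMoment μ p (fun ω => ⨆ t, ‖X t ω‖ₑ) ≤
          ENNReal.ofReal C₀ * PhiSub.gammaTilde φ p d +
            ⨅ t₀ : T, (2 * (⨆ t, PhiSub.lpMoment μ p (fun ω => ‖X t ω - X t₀ ω‖ₑ)) +
              PhiSub.lpMoment μ p (fun ω => ‖X t₀ ω‖ₑ))) ∧
        -- its consequence for the increments
        (∀ t₀ : T, PhiSub.lpMoment μ p (fun ω => ⨆ t, ‖X t ω - X t₀ ω‖ₑ) ≤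
          ENNReal.ofReal C₁ * PhiSub.gammaTilde φ p d +
            ENNReal.ofReal (C₂ φ * Real.sqrt p) * PhiSub.diameter d +
            ENNReal.ofReal (C₃ φ * p) * PhiSub.diameter d) ∧
        -- its consequence for the process itself
        (∀ t₀ : T, PhiSub.lpMoment μ p (fun ω => ⨆ t, ‖X t ω‖ₑ) ≤
          ENNReal.ofReal C₁ * PhiSub.gammaTilde φ p d +
            ENNReal.ofReal (C₂ φ * Real.sqrt p) *
              (PhiSub.diameter d + PhiSub.tau φ μ (X t₀)) +
            ENNReal.ofReal (C₃ φ * p) *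
              (PhiSub.diameter d + PhiSub.tau φ μ (X t₀))) ∧
        -- the tail bounds
        (PhiSub.diameter d ≠ 0 → PhiSub.gammaTilde φ p d ≠ ∞ →
          ∀ (t₀ : T) (u : ℝ), Real.sqrt 2 ≤ u →
            (p ≤ max 1 (PhiSub.conj φ u) →
              μ {ω | ENNReal.ofReal (C₄ φ * PhiSub.conj φ u) * PhiSub.diameter d +
                    ENNReal.ofReal (C₅ φ * Real.sqrt (PhiSub.conj φ u)) * PhiSub.diameter d +
                    ENNReal.ofReal C₆ * PhiSub.gammaTilde φ p d ≤
                  ⨆ t, ‖X t ω - X t₀ ω‖ₑ} ≤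
                ENNReal.ofReal (Real.exp (-PhiSub.conj φ u))) ∧
            μ {ω | ENNReal.ofReal (C₄ φ * max p (PhiSub.conj φ u)) * PhiSub.diameter d +
                  ENNReal.ofReal (C₅ φ * Real.sqrt (max p (PhiSub.conj φ u))) *
                    PhiSub.diameter d +
                  ENNReal.ofReal C₆ * PhiSub.gammaTilde φ p d ≤
                ⨆ t, ‖X t ω - X t₀ ω‖ₑ} ≤
              ENNReal.ofReal (Real.exp (-PhiSub.conj φ u))) := by
  -- The factor `exp 1` comes from Markov's inequality. The square-root constants can be any
  -- positive number. Dividing by `conjFloor φ` pays for replacing `max 1 (φ*(u))` by `φ*(u)`.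
  refine ⟨48, 48, 48 * Real.exp 1, fun _ => 1, fun φ => 4 * Real.exp (φ 1),
    fun φ => Real.exp 1 * (4 * Real.exp (φ 1)) / PhiSub.conjFloor φ, fun _ => 1,
    ⟨by norm_num, by norm_num, by positivity, fun φ => ⟨one_pos, by positivity, ?_, one_pos⟩⟩,
    fun φ ψ hφ hψ => ?_, ?_⟩
  · have := PhiSub.conjFloor_pos φ
    positivity
  · simp [PhiSub.conjFloor, hφ, hψ, hφ.apply_one, hψ.apply_one]
  intro φ h _ Ω _ μ _ T X hX hsep d hd p hp
  subst hd
  rw [ENNReal.ofReal_ofNat]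
  refine ⟨?_, fun t₀ => ?_, fun t₀ => ?_, fun hΔ hγ t₀ u hu => ?_⟩
  · rcases isEmpty_or_nonempty T with hT | hT
    · rw [iInf_of_empty, add_top]; exact le_top
    · rw [ENNReal.add_iInf]
      refine le_iInf fun t₀ => ?_
      rw [← add_assoc]
      exact (PhiSub.lpMoment_iSup_le hX hsep hp t₀).trans
        (add_le_add (PhiSub.lpMoment_iSup_sub_le h hX hsep hp t₀) le_rfl)
  · refine (PhiSub.lpMoment_iSup_sub_le_diameter h hX hsep hp t₀).trans ?_
    exact add_le_add le_self_add le_rfl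
  · refine (PhiSub.lpMoment_iSup_le hX hsep hp t₀).trans ?_
    refine (add_le_add (PhiSub.lpMoment_iSup_sub_le_diameter h hX hsep hp t₀)
      (PhiSub.lpMoment_le_tau h (hX t₀).aemeasurable hp)).trans ?_
    rw [mul_add (ENNReal.ofReal (4 * Real.exp (φ 1) * p)), add_assoc]
    refine add_le_add le_self_add (add_le_add le_rfl ?_)
    gcongr
    norm_num
  · have hc := PhiSub.conjFloor_pos φ
    have hmax := PhiSub.conjFloor_mul_max_le h hu
    have hc1 : PhiSub.conjFloor φ ≤ 1 := PhiSub.conjFloor_le_one φ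
    refine ⟨fun hpu => ?_, ?_⟩
    -- Order `q = max 1 (φ*(u))`: moments need `q ≥ 1`, while `φ*(u)` may be smaller than 1.
    · refine (PhiSub.measure_iSup_sub_ge_le h hX hsep hp hΔ hγ t₀ hpu ?_).trans ?_
      · rw [div_mul_eq_mul_div, le_div_iff₀ hc]
        calc _ = Real.exp 1 * (4 * Real.exp (φ 1)) *
              (PhiSub.conjFloor φ * max 1 (PhiSub.conj φ u)) := by ring
          _ ≤ _ := by gcongr
      · gcongr
        exact le_max_right _ _
    -- Order `q = max p (φ*(u))`, which is already in the threshold; here `conjFloor φ ≤ 1` is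
    -- enough.
    · refine (PhiSub.measure_iSup_sub_ge_le h hX hsep hp hΔ hγ t₀
        (le_max_left p (PhiSub.conj φ u)) ?_).trans ?_
      · have : 0 < max p (PhiSub.conj φ u) := by
          have := le_max_left p (PhiSub.conj φ u)
          linarith
        rw [div_mul_eq_mul_div, le_div_iff₀ hc, ← mul_assoc (Real.exp 1)]
        exact mul_le_of_le_one_right (by positivity) hc1
      · gcongr
        exact le_max_right _ _
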